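/- Let $X$ and $U$ be real Hilbert spaces, $\mathcal N\subset\mathbb R^d$ compact, $T>0$ and $x^0,x^1\in X$. For each $\nu\in\mathcal N$ let $A_\nu\in\mathcal L(X)$ and $B_\nu\in\mathcal L(U,X)$ be bounded operators such that $\nu\mapsto(A_\nu,B_\nu)$ is (real) analytic on $\mathcal N$ with respect to the operator norms, i.e. near each point of $\mathcal N$ it is given on $\mathcal N$ by a convergent power series. Consider the control systems $x'=A_\nu x+B_\nu u$ on $(0,T)$, $x(0)=x^0$, with target $x(T)=x^1$, and their Gramians $$\Lambda_\nu=\int_0^T e^{(T-t)A_\nu}B_\nu B_\nu^*e^{(T-t)A_\nu^*}\,dt ,$$ and assume uniform controllability: there are constants $\Lambda_\pm>0$ with $\Lambda_-I\le\Lambda_\nu\le\Lambda_+I$ for all $\nu\in\mathcal N$. Then for each $\nu\in\mathcal N$ the equation $\Lambda_\nu\varphi=x^1-e^{TA_\nu}x^0$ has exactly one solution $\varphi^0_\nu$; it is the unique minimiser over $\varphi^0\in X$ of $$J_\nu(\varphi^0)=\tfrac12\int_0^T\|B_\nu^*\varphi(t)\|^2dt-\langle x^1,\varphi^0\rangle+\langle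 x^0,\varphi(0)\rangle,\qquad \varphi(t)=e^{(T-t)A_\nu^*}\varphi^0,$$ and $\nu\mapsto\varphi^0_\nu$ is Lipschitz on $\mathcal N$. The greedy control algorithm with tolerance $\varepsilon>0$ runs as follows. Take a finite set $\tilde{\mathcal N}\subset\mathcal N$ with $\mathrm{dist}(\nu,\tilde{\mathcal N})<\delta$ for all $\nu\in\mathcal N$, where $\delta>0$ satisfies $2C_\varphi\Lambda_-\delta\le\varepsilon$ for a Lipschitz constant $C_\varphi$ of $\nu\mapsto\varphi_\nu^0$ on $\mathcal N$. Having selected $\nu_1,\dots,\nu_j$ ($j\ge0$), put $\varphi_i^0=\varphi^0_{\nu_i}$ and $\Phi_j^0=\mathrm{span}\{\varphi_1^0,\dots,\varphi_j^0\}$ (so $\Phi_0^0=\{0\}$); stop if $\max_{\tilde\nu\in\tilde{\mathcal N}}\mathrm{dist}(x^1-e^{TA_{\tilde\nu}}x^0,\Lambda_{\tilde\nu}\Phi_j^0)<\varepsilon/2$, and otherwise let $\nu_{j+1}\in\tilde{\mathcal N}$ be a point at which this maximum is attained. Then the approximation errors of the algorithm decay polynomially at every order: for each $\alpha>0$ there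 is $C_\alpha>0$, independent of $\varepsilon$, $C_\varphi$, $\delta$, $\tilde{\mathcal N}$ and of the choices of maximisers, such that for every run of the algorithm, every $n\ge1$ for which $\nu_1,\dots,\nu_n$ have been selected, and every $\nu\in\mathcal N$, $$\mathrm{dist}\big(\varphi^0_\nu,\ \mathrm{span}\{\varphi^0_1,\dots,\varphi^0_n\}\big)\le C_\alpha n^{-\alpha}.$$ -/

import Mathlib

open scoped InnerProductSpace

noncomputable section

namespace GreedyControl

section System

variable {X U : Type*} [NormedAddCommGroup X] [InnerProductSpace ℝ X] [CompleteSpace X]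
  [NormedAddCommGroup U] [InnerProductSpace ℝ U] [CompleteSpace U]

/-- The controllability Gramian `∫₀ᵀ e^{(T-t)A} B B* e^{(T-t)A*} dt` of `x' = A x + B u`
with bounded operators `A` on `X` and `B : U → X`. -/
def gramian (T : ℝ) (A : X →L[ℝ] X) (B : U →L[ℝ] X) : X →L[ℝ] X :=
  ∫ t in (0 : ℝ)..T,
    NormedSpace.exp ((T - t) • A) ∘L B ∘L ContinuousLinearMap.adjoint B ∘L
      NormedSpace.exp ((T - t) • ContinuousLinearMap.adjoint A)

/-- The solution at time `t` of the adjoint problem `-φ' = A* φ`, `φ(T) = φ⁰`. -/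
def adjointState (T : ℝ) (A : X →L[ℝ] X) (p : X) (t : ℝ) : X :=
  NormedSpace.exp ((T - t) • ContinuousLinearMap.adjoint A) p

/-- The quadratic functional
`J(φ⁰) = ½ ∫₀ᵀ |B* φ(t)|² dt - ⟨x¹, φ⁰⟩ + ⟨x⁰, φ(0)⟩`. -/
def costJ (T : ℝ) (A : X →L[ℝ] X) (B : U →L[ℝ] X) (x₀ x₁ : X) (p : X) : ℝ :=
  1 / 2 * (∫ t in (0 : ℝ)..T, ‖ContinuousLinearMap.adjoint B (adjointState T A p t)‖ ^ 2)
    - ⟪x₁, p⟫_ℝ + ⟪x₀, adjointState T A p 0⟫_ℝ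

/-- The vector `x¹ - e^{TA} x⁰`. -/
def target (T : ℝ) (A : X →L[ℝ] X) (x₀ x₁ : X) : X :=
  x₁ - NormedSpace.exp (T • A) x₀

/-- The datum `φ⁰ = Λ⁻¹ (x¹ - e^{TA} x⁰)`, where `Λ` is the Gramian
(`0` if `Λ` is not invertible). -/
def minimiser (T : ℝ) (A : X →L[ℝ] X) (B : U →L[ℝ] X) (x₀ x₁ : X) : X :=
  (gramian T A B).inverse (target T A x₀ x₁)

end System

section Algorithm

variable {P : Type*} [MetricSpace P]
  {X U : Type*} [NormedAddCommGroup X] [InnerProductSpace ℝ X] [CompleteSpace X]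
  [NormedAddCommGroup U] [InnerProductSpace ℝ U] [CompleteSpace U]

/-- Uniform controllability: `Λ₋ I ≤ Λ_ν ≤ Λ₊ I` for all `ν ∈ 𝒩`, as quadratic forms. -/
def UniformlyControllable (T : ℝ) (A : P → X →L[ℝ] X) (B : P → U →L[ℝ] X) (𝒩 : Set P)
    (lamMinus lamPlus : ℝ) : Prop :=
  ∀ ν ∈ 𝒩, ∀ x : X, lamMinus * ‖x‖ ^ 2 ≤ ⟪gramian T (A ν) (B ν) x, x⟫_ℝ ∧
    ⟪gramian T (A ν) (B ν) x, x⟫_ℝ ≤ lamPlus * ‖x‖ ^ 2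

/-- The minimiser `φ⁰_ν` of the system with parameter `ν`. -/
def phi (T : ℝ) (A : P → X →L[ℝ] X) (B : P → U →L[ℝ] X) (x₀ x₁ : X) (ν : P) : X :=
  minimiser T (A ν) (B ν) x₀ x₁

/-- The span `Φ⁰_j` of the first `j` snapshots `φ⁰_{sel 0}, …, φ⁰_{sel (j-1)}`;
it is `{0}` for `j = 0`. -/
def snapshotSpan (T : ℝ) (A : P → X →L[ℝ] X) (B : P → U →L[ℝ] X) (x₀ x₁ : X)
    (sel : ℕ → P) (j : ℕ) : Submodule ℝ X :=
  Submodule.span ℝ ((fun i => phi T A B x₀ x₁ (sel i)) '' Set.Iio j)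

/-- The surrogate distance `dist(x¹ - e^{T A_ν} x⁰, Λ_ν Φ⁰_j)`. -/
def surrogate (T : ℝ) (A : P → X →L[ℝ] X) (B : P → U →L[ℝ] X) (x₀ x₁ : X)
    (sel : ℕ → P) (j : ℕ) (ν : P) : ℝ :=
  Metric.infDist (target T (A ν) x₀ x₁)
    (gramian T (A ν) (B ν) '' (snapshotSpan T A B x₀ x₁ sel j : Set X))

/-- `D` is a finite subset of `𝒩` with `dist(ν, D) < δ` for all `ν ∈ 𝒩`. -/
def IsDiscretisation (𝒩 : Set P) (D : Finset P) (δ : ℝ) : Prop :=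
  (D : Set P) ⊆ 𝒩 ∧ ∀ ν ∈ 𝒩, ∃ μ ∈ D, dist ν μ < δ

/-- The greedy control algorithm with tolerance `ε`, searching over the finite set `D`, can select
successively `sel 0, …, sel (n-1)`: at each stage `j < n` the stopping criterion
`max_{μ ∈ D} surrogate < ε / 2` fails, and `sel j` maximises the surrogate over `D`. -/
def IsGreedyRun (T : ℝ) (A : P → X →L[ℝ] X) (B : P → U →L[ℝ] X) (x₀ x₁ : X)
    (ε : ℝ) (D : Finset P) (sel : ℕ → P) (n : ℕ) : Prop :=
  ∀ j < n,
    ¬ (∀ μ ∈ D, surrogate T A B x₀ x₁ sel j μ < ε / 2) ∧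
    sel j ∈ D ∧
    ∀ μ ∈ D, surrogate T A B x₀ x₁ sel j μ ≤ surrogate T A B x₀ x₁ sel j (sel j)

end Algorithm

end GreedyControl

end

/-! The map `ν ↦ φ⁰_ν = Λ_ν⁻¹ (x¹ - e^{TA_ν} x⁰)` is analytic: the Gramian is analytic in `(A, B)`,
it is invertible by coercivity, and inversion is analytic on units. On a compact set a function of
`d` variables with this property is approximated by Taylor polynomials with geometric error `C a^k`,
from spaces of dimension `O(k^(d+1))`. So the solution set has rapidly decaying Kolmogorov widths
(`exists_widths_le_of_analyticOn`).

The algorithm is a weak greedy selection for this set. Since `x¹ - e^{TA_ν} x⁰ = Λ_ν φ⁰_ν`, the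
surrogate is comparable with the true distance, with constants `Λ₋` and a bound `M` for `‖Λ_ν‖`.
Passing from `𝒩` to the finite net costs `Λ₋ C_φ δ ≤ ε/2`, and as long as the algorithm has not
stopped this is at most the maximal surrogate. The weakness constant `2M/Λ₋` therefore depends on
neither `ε` nor the net.

Weak greedy errors inherit the decay of the widths. In a block of steps much longer than `dim V`,
the orthonormalised residuals cannot all be close to `V`, so the error is halved up to a multiple of
the distance to `V` (`le_of_le_residuals`, `weakGreedy_infDist_le`). Taking `k` blocks of length
`O(k^(d+1))` gives an error exponentially small in `k` after `O(k^(d+2))` steps, which beats every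
power of `n`. -/

open scoped InnerProductSpace Topology

namespace GreedyControl

/-! ### Weak greedy selection in a Hilbert space -/

section WeakGreedy

variable {E : Type*} [NormedAddCommGroup E] [InnerProductSpace ℝ E]

/-- The squared norms of the projections of an orthonormal family onto a finite-dimensional
subspace sum up to at most its dimension. -/
theorem sum_norm_starProjection_sq_le (V : Submodule ℝ E) [FiniteDimensional ℝ V]
    {ι : Type*} {e : ι → E} (he : Orthonormal ℝ e) (s : Finset ι) :
    ∑ i ∈ s, ‖V.starProjection (e i)‖ ^ 2 ≤ Module.finrank ℝ V := by
  set b := stdOrthonormalBasis ℝ V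
  have h1 : ∀ x : E, ‖V.starProjection x‖ ^ 2 = ∑ k, ‖⟪x, (b k : E)⟫_ℝ‖ ^ 2 := by
    intro x
    have h2 := b.sum_sq_norm_inner_right (V.orthogonalProjectionOnto x)
    rw [Submodule.starProjection_apply, ← Submodule.coe_norm, ← h2]
    refine Finset.sum_congr rfl fun k _ => ?_
    rw [real_inner_comm, Submodule.coe_inner, ← Submodule.starProjection_apply,
      Submodule.inner_starProjection_left_eq_right,
      Submodule.starProjection_eq_self_iff.mpr (b k).2]
  simp_rw [h1]
  rw [Finset.sum_comm]
  calc ∑ k, ∑ i ∈ s, ‖⟪e i, (b k : E)⟫_ℝ‖ ^ 2 ≤ ∑ k, ‖(b k : E)‖ ^ 2 :=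
        Finset.sum_le_sum fun k _ => he.sum_inner_products_le _
    _ = Module.finrank ℝ V := by
        have h3 : ∀ k, ‖(b k : E)‖ = 1 := fun k => b.orthonormal.1 k
        simp [h3]

theorem norm_sub_starProjection_eq_infDist (V : Submodule ℝ E) [V.HasOrthogonalProjection]
    (x : E) : ‖x - V.starProjection x‖ = Metric.infDist x V := by
  rw [Submodule.starProjection_minimal, Metric.infDist_eq_iInf]
  simp_rw [dist_eq_norm]
  rfl

instance finiteDimensional_span_image_Iio (φ : ℕ → E) (j : ℕ) :
    FiniteDimensional ℝ (Submodule.span ℝ (φ '' Set.Iio j)) :=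
  FiniteDimensional.span_of_finite ℝ ((Set.finite_Iio j).image φ)

theorem span_image_Iio_mono (φ : ℕ → E) {i j : ℕ} (hij : i ≤ j) :
    Submodule.span ℝ (φ '' Set.Iio i) ≤ Submodule.span ℝ (φ '' Set.Iio j) :=
  Submodule.span_mono (Set.image_mono (Set.Iio_subset_Iio hij))

theorem infDist_span_image_Iio_anti (φ : ℕ → E) {i j : ℕ} (hij : i ≤ j) (x : E) :
    Metric.infDist x (Submodule.span ℝ (φ '' Set.Iio j) : Set E) ≤
      Metric.infDist x (Submodule.span ℝ (φ '' Set.Iio i) : Set E) :=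
  Metric.infDist_le_infDist_of_subset (span_image_Iio_mono φ hij) ⟨0, Submodule.zero_mem _⟩

/-- This is Gram–Schmidt started at index `k`: each residual lies in the span to which all later
residuals are orthogonal. -/
theorem orthonormal_normalised_residuals (φ : ℕ → E) (k l : ℕ)
    (hne : ∀ i < l, φ (k + i) -
      (Submodule.span ℝ (φ '' Set.Iio (k + i))).starProjection (φ (k + i)) ≠ 0) :
    Orthonormal ℝ (fun i : Fin l =>
      ‖φ (k + i) - (Submodule.span ℝ (φ '' Set.Iio (k + i))).starProjection (φ (k + i))‖⁻¹ •
        (φ (k + i) - (Submodule.span ℝ (φ '' Set.Iio (k + i))).starProjection (φ (k + i)))) := by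
  have key : ∀ i j : ℕ, i < j →
      ⟪φ i - (Submodule.span ℝ (φ '' Set.Iio i)).starProjection (φ i),
        φ j - (Submodule.span ℝ (φ '' Set.Iio j)).starProjection (φ j)⟫_ℝ = 0 := by
    intro i j hij
    refine Submodule.inner_right_of_mem_orthogonal (K := Submodule.span ℝ (φ '' Set.Iio j))
      (Submodule.sub_mem _ (Submodule.subset_span ⟨i, hij, rfl⟩) ?_)
      (Submodule.sub_starProjection_mem_orthogonal _)
    exact span_image_Iio_mono φ hij.le (Submodule.starProjection_apply_mem _ _)
  refine ⟨fun i => ?_, fun i j hij => ?_⟩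
  · rw [norm_smul, norm_inv, norm_norm, inv_mul_cancel₀ (norm_ne_zero_iff.mpr (hne i i.2))]
  · dsimp only
    rw [real_inner_smul_left, real_inner_smul_right]
    rcases lt_or_gt_of_ne (Fin.val_ne_of_ne hij) with h | h
    · rw [key _ _ (Nat.add_lt_add_left h k)]; simp
    · rw [real_inner_comm, key _ _ (Nat.add_lt_add_left h k)]; simp

/-- Among `l` consecutive residuals of a sequence, one is small if the sequence is close to a
subspace whose dimension is small compared to `l`. -/
theorem le_of_le_residuals (φ : ℕ → E) (k l : ℕ) (V : Submodule ℝ E) [FiniteDimensional ℝ V]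
    {K d σ r : ℝ} (hK : 0 < K) (hl : 0 < l) (hKl : K ^ 2 * Module.finrank ℝ V ≤ l)
    (hd : 0 ≤ d) (hσ : 0 ≤ σ)
    (hV : ∀ i < l, ∃ v ∈ V, ‖φ (k + i) - v‖ ≤ d)
    (hσk : ∀ i < l, Metric.infDist (φ (k + i)) (Submodule.span ℝ (φ '' Set.Iio k) : Set E) ≤ σ)
    (hr : ∀ i < l, r ≤ Metric.infDist (φ (k + i))
      (Submodule.span ℝ (φ '' Set.Iio (k + i)) : Set E)) :
    r ≤ σ / K + d := by
  -- A vanishing residual already forces `r ≤ 0`; otherwise all residuals can be normalised.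
  by_cases hne : ∀ i < l, φ (k + i) -
      (Submodule.span ℝ (φ '' Set.Iio (k + i))).starProjection (φ (k + i)) ≠ 0
  swap
  · push Not at hne
    obtain ⟨i, hi, h0⟩ := hne
    have := hr i hi
    rw [← norm_sub_starProjection_eq_infDist, h0, norm_zero] at this
    have : 0 ≤ σ / K := by positivity
    linarith
  have he := orthonormal_normalised_residuals φ k l hne
  set e : Fin l → E := fun i =>
      ‖φ (k + i) - (Submodule.span ℝ (φ '' Set.Iio (k + i))).starProjection (φ (k + i))‖⁻¹ •
        (φ (k + i) - (Submodule.span ℝ (φ '' Set.Iio (k + i))).starProjection (φ (k + i)))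
    with hedef
  set S := Submodule.span ℝ (φ '' Set.Iio k) with hS
  -- The vectors `e i` are orthogonal to `S`, so only components in `Sᗮ` matter. Projecting `V`
  -- there neither raises its dimension nor worsens the approximation.
  set W := V.map (Sᗮ.starProjection : E →ₗ[ℝ] E) with hW
  have hWV : (Module.finrank ℝ W : ℝ) ≤ Module.finrank ℝ V := by
    exact_mod_cast Submodule.finrank_map_le _ V
  -- Pigeonhole: the `l` squared norms sum to at most `dim V ≤ l / K ^ 2`.
  obtain ⟨i, -, hi⟩ : ∃ i ∈ (Finset.univ : Finset (Fin l)),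
      ‖W.starProjection (e i)‖ ^ 2 ≤ (1 / K) ^ 2 := by
    have : Nonempty (Fin l) := ⟨⟨0, hl⟩⟩
    refine Finset.exists_le_of_sum_le Finset.univ_nonempty ?_
    refine (sum_norm_starProjection_sq_le W he _).trans (hWV.trans ?_)
    simp only [Finset.sum_const, Finset.card_univ, Fintype.card_fin, nsmul_eq_mul]
    rw [div_pow, one_pow, mul_one_div, le_div_iff₀ (by positivity)]
    linarith
  replace hi : ‖W.starProjection (e i)‖ ≤ 1 / K :=
    le_of_sq_le_sq hi (by positivity)
  obtain ⟨v, hv, hvd⟩ := hV i i.2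
  set x := φ (k + i) with hx
  set y := Sᗮ.starProjection x with hy
  set w := x - (Submodule.span ℝ (φ '' Set.Iio (k + i))).starProjection x with hw
  have hyn : ‖y‖ ≤ σ := by
    have : y = x - S.starProjection x := by
      rw [hy, Submodule.starProjection_orthogonal']; simp
    rw [this, norm_sub_starProjection_eq_infDist]
    exact hσk i i.2
  have hwo : w ∈ (Submodule.span ℝ (φ '' Set.Iio (k + i)))ᗮ :=
    Submodule.sub_starProjection_mem_orthogonal _
  have hwS : w ∈ Sᗮ :=
    Submodule.orthogonal_le (span_image_Iio_mono φ (Nat.le_add_right k i)) hwo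
  have hei : e i = ‖w‖⁻¹ • w := rfl
  have heS : e i ∈ Sᗮ := by rw [hei]; exact Submodule.smul_mem _ _ hwS
  have hw0 : ‖w‖ ≠ 0 := norm_ne_zero_iff.mpr (hne i i.2)
  have h1 : ‖w‖ = ⟪x, e i⟫_ℝ := by
    have hxw : ⟪x, w⟫_ℝ = ‖w‖ ^ 2 := by
      have : x = w + (Submodule.span ℝ (φ '' Set.Iio (k + i))).starProjection x := by
        rw [hw]; abel
      conv_lhs => rw [this]
      rw [inner_add_left, Submodule.inner_right_of_mem_orthogonal
        (Submodule.starProjection_apply_mem _ _) hwo, real_inner_self_eq_norm_sq, add_zero]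
    rw [hei, real_inner_smul_right, hxw]
    field_simp
  have h2 : ⟪x, e i⟫_ℝ = ⟪y, e i⟫_ℝ := by
    rw [hy, Submodule.inner_starProjection_left_eq_right,
      Submodule.starProjection_eq_self_iff.mpr heS]
  have h3 : ⟪y, e i⟫_ℝ = ⟪y, W.starProjection (e i)⟫_ℝ + ⟪y - W.starProjection y, e i⟫_ℝ := by
    rw [inner_sub_left, W.inner_starProjection_left_eq_right]; ring
  have h4 : ⟪y, W.starProjection (e i)⟫_ℝ ≤ σ / K := by
    calc _ ≤ ‖y‖ * ‖W.starProjection (e i)‖ := real_inner_le_norm _ _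
      _ ≤ σ * (1 / K) := by gcongr
      _ = σ / K := by ring
  have h5 : ⟪y - W.starProjection y, e i⟫_ℝ ≤ d := by
    have hyv : ‖y - W.starProjection y‖ ≤ d := by
      rw [norm_sub_starProjection_eq_infDist]
      have hm : Sᗮ.starProjection v ∈ (W : Set E) := ⟨v, hv, rfl⟩
      refine (Metric.infDist_le_dist_of_mem hm).trans ?_
      rw [dist_eq_norm, hy, ← map_sub]
      exact (Submodule.norm_starProjection_apply_le _ _).trans hvd
    calc _ ≤ ‖y - W.starProjection y‖ * ‖e i‖ := real_inner_le_norm _ _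
      _ ≤ d := by rw [he.1 i, mul_one]; exact hyv
  have h6 := hr i i.2
  rw [← norm_sub_starProjection_eq_infDist] at h6
  change r ≤ ‖w‖ at h6
  linarith

/-- Error bound for a weak greedy selection from `S`, in terms of the distance of `S` to a
finite-dimensional subspace. -/
theorem weakGreedy_infDist_le {S : Set E} {φ : ℕ → E} {n₀ : ℕ} {Γ M d : ℝ} {K m : ℕ}
    (hΓ : 0 < Γ) (hK : 2 * Γ ≤ K) (hm : 0 < m) (hd : 0 ≤ d)
    (hM : ∀ x ∈ S, ‖x‖ ≤ M) (hφ : ∀ j < n₀, φ j ∈ S)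
    (hgreedy : ∀ j < n₀, ∀ x ∈ S,
      Metric.infDist x (Submodule.span ℝ (φ '' Set.Iio j) : Set E) ≤
        Γ * Metric.infDist (φ j) (Submodule.span ℝ (φ '' Set.Iio j) : Set E))
    (V : Submodule ℝ E) [FiniteDimensional ℝ V] (hVm : Module.finrank ℝ V ≤ m)
    (hV : ∀ x ∈ S, ∃ v ∈ V, ‖x - v‖ ≤ d) (p : ℕ) (hp : p * (K ^ 2 * m) ≤ n₀) :
    ∀ x ∈ S, Metric.infDist x (Submodule.span ℝ (φ '' Set.Iio (p * (K ^ 2 * m))) : Set E) ≤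
      M * (1 / 2) ^ p + 2 * Γ * d := by
  have hK0 : (0 : ℝ) < K := by linarith
  have hl : 0 < K ^ 2 * m := by
    have : 0 < K := by exact_mod_cast hK0
    positivity
  induction p with
  | zero =>
    intro x hx
    have h0 := Metric.infDist_le_dist_of_mem (x := x)
      (Submodule.zero_mem (Submodule.span ℝ (φ '' Set.Iio (0 * (K ^ 2 * m)))))
    rw [dist_zero_right] at h0
    have := hM x hx
    have : 0 ≤ 2 * Γ * d := by positivity
    simp only [pow_zero, mul_one]
    exact h0.trans (by linarith)
  | succ p ih =>
    intro x hx
    set l := K ^ 2 * m with hldef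
    have hple : p * l + l ≤ n₀ := by rw [← Nat.succ_mul]; exact hp
    specialize ih (by omega)
    have hM0 : 0 ≤ M := (norm_nonneg x).trans (hM x hx)
    -- Every residual in the block is at least the error of `x` after the block, divided by `Γ`: the
    -- greedy inequality gives this for the current span, and the spans only grow.
    have key := le_of_le_residuals φ (p * l) l V (K := K) (d := d)
      (σ := M * (1 / 2) ^ p + 2 * Γ * d)
      (r := Metric.infDist x (Submodule.span ℝ (φ '' Set.Iio ((p + 1) * l)) : Set E) / Γ)
      hK0 hl
      (by
        rw [hldef]
        push_cast
        have : (Module.finrank ℝ V : ℝ) ≤ m := by exact_mod_cast hVm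
        gcongr)
      hd (by positivity)
      (fun i hi => hV _ (hφ _ (by omega)))
      (fun i hi => ih _ (hφ _ (by omega)))
      (fun i hi => by
        rw [div_le_iff₀ hΓ, mul_comm _ Γ]
        refine le_trans ?_ (hgreedy (p * l + i) (by omega) x hx)
        exact infDist_span_image_Iio_anti φ (by rw [Nat.succ_mul]; omega) x)
    rw [div_le_iff₀ hΓ] at key
    refine key.trans ?_
    -- With `K ≥ 2Γ` the errors obey `σ' ≤ σ / 2 + Γ d`, whose fixed point `2Γd` is the additive
    -- term of the bound.
    have h7 : (M * (1 / 2) ^ p + 2 * Γ * d) / K * Γ ≤ (M * (1 / 2) ^ p + 2 * Γ * d) / 2 := by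
      rw [div_mul_eq_mul_div, div_le_div_iff₀ hK0 (by norm_num)]
      have : 0 ≤ M * (1 / 2) ^ p + 2 * Γ * d := by positivity
      nlinarith
    rw [pow_succ]
    linarith

end WeakGreedy

end GreedyControl

namespace GreedyControl

/-! ### Kolmogorov widths of analytic images -/

section Widths

/-- The partial sums of degree less than `k` of a power series in `d` variables take values in a
space whose dimension grows polynomially in `k`. -/
theorem exists_finrank_le_partialSum_mem {d : ℕ} {F : Type*} [NormedAddCommGroup F]
    [NormedSpace ℝ F] (p : FormalMultilinearSeries ℝ (EuclideanSpace ℝ (Fin d)) F) (k : ℕ) :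
    ∃ V : Submodule ℝ F, FiniteDimensional ℝ V ∧ Module.finrank ℝ V ≤ k ^ (d + 1) ∧
      ∀ y, p.partialSum k y ∈ V := by
  classical
  let b : Fin d → EuclideanSpace ℝ (Fin d) := fun i => EuclideanSpace.single i 1
  -- Words in the coordinate directions are grouped by their monomial. There are at most `k * k ^ d`
  -- pairs of a degree and exponents below `k`, whereas the number of words of length `j` is `d ^
  -- j`.
  let cnt : (j : Fin k) → (Fin j → Fin d) → Fin d → Fin k := fun j f i =>
    ⟨(Finset.univ.filter fun l => f l = i).card, lt_of_le_of_lt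
      ((Finset.card_le_univ _).trans_eq (Fintype.card_fin _)) j.2⟩
  let g : Fin k × (Fin d → Fin k) → F := fun c =>
    ∑ f ∈ Finset.univ.filter (fun f : Fin c.1 → Fin d => cnt c.1 f = c.2), p c.1 (fun l => b (f l))
  refine ⟨Submodule.span ℝ (Set.range g), FiniteDimensional.span_of_finite ℝ (Set.finite_range g),
    (finrank_range_le_card g).trans ?_, fun y => ?_⟩
  · simp [pow_succ, mul_comm]
  rw [FormalMultilinearSeries.partialSum, Finset.sum_range]
  refine Submodule.sum_mem _ fun j _ => ?_
  have hy : y = ∑ i, y i • b i := by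
    ext i
    simp [b, Pi.single_apply]
  have h1 : (p j fun _ => y) = ∑ f : Fin j → Fin d, (∏ l, y (f l)) • p j fun l => b (f l) := by
    conv_lhs => rw [hy]
    rw [ContinuousMultilinearMap.map_sum]
    exact Finset.sum_congr rfl fun f _ => ContinuousMultilinearMap.map_smul_univ _ _ _
  rw [h1, ← Finset.sum_fiberwise Finset.univ (cnt j)]
  refine Submodule.sum_mem _ fun c _ => ?_
  have h2 : ∑ f ∈ Finset.univ.filter (fun f => cnt j f = c),
      ((∏ l, y (f l)) • p j fun l => b (f l)) = (∏ i, y i ^ (c i : ℕ)) • g (j, c) := by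
    rw [Finset.smul_sum]
    refine Finset.sum_congr rfl fun f hf => ?_
    congr 1
    obtain rfl : cnt j f = c := (Finset.mem_filter.mp hf).2
    rw [← Finset.prod_fiberwise Finset.univ f]
    refine Finset.prod_congr rfl fun i _ => ?_
    rw [Finset.prod_congr rfl fun l hl => by rw [(Finset.mem_filter.mp hl).2], Finset.prod_const]
  rw [h2]
  exact Submodule.smul_mem _ _ (Submodule.subset_span ⟨(j, c), rfl⟩)

/-- The Kolmogorov widths of the image of a compact set under an analytic map of `d` variables
decay exponentially in the `d + 1`-st root of the dimension. -/
theorem exists_widths_le_of_analyticOn {d : ℕ} {F : Type*} [NormedAddCommGroup F]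
    [NormedSpace ℝ F] [CompleteSpace F] {f : EuclideanSpace ℝ (Fin d) → F}
    {s : Set (EuclideanSpace ℝ (Fin d))} (hs : IsCompact s) (hf : AnalyticOn ℝ f s) :
    ∃ (N : ℕ) (C a : ℝ), 0 < C ∧ 0 < a ∧ a < 1 ∧ ∀ k : ℕ, ∃ V : Submodule ℝ F,
      FiniteDimensional ℝ V ∧ Module.finrank ℝ V ≤ N * k ^ (d + 1) ∧
      ∀ x ∈ s, ∃ v ∈ V, ‖f x - v‖ ≤ C * a ^ k := by
  refine hs.induction_on (p := fun s => ∃ (N : ℕ) (C a : ℝ), 0 < C ∧ 0 < a ∧ a < 1 ∧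
    ∀ k : ℕ, ∃ V : Submodule ℝ F, FiniteDimensional ℝ V ∧
      Module.finrank ℝ V ≤ N * k ^ (d + 1) ∧ ∀ x ∈ s, ∃ v ∈ V, ‖f x - v‖ ≤ C * a ^ k) ?_ ?_ ?_ ?_
  · exact ⟨0, 1, 1 / 2, by norm_num, by norm_num, by norm_num,
      fun k => ⟨⊥, inferInstance, by simp, by simp⟩⟩
  · rintro s t hst ⟨N, C, a, hC, ha, ha1, h⟩
    refine ⟨N, C, a, hC, ha, ha1, fun k => ?_⟩
    obtain ⟨V, h1, h2, h3⟩ := h k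
    exact ⟨V, h1, h2, fun x hx => h3 x (hst hx)⟩
  · rintro s t ⟨N, C, a, hC, ha, ha1, h⟩ ⟨N', C', a', hC', ha', ha1', h'⟩
    refine ⟨N + N', max C C', max a a', lt_max_of_lt_left hC, lt_max_of_lt_left ha,
      max_lt ha1 ha1', fun k => ?_⟩
    obtain ⟨V, h1, h2, h3⟩ := h k
    obtain ⟨V', h1', h2', h3'⟩ := h' k
    refine ⟨V ⊔ V', inferInstance, ?_, ?_⟩
    · exact (Submodule.finrank_add_le_finrank_add_finrank V V').trans (by linarith)
    · rintro x (hx | hx)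
      · obtain ⟨v, hv, hvx⟩ := h3 x hx
        refine ⟨v, Submodule.mem_sup_left hv, hvx.trans ?_⟩
        gcongr
        · exact le_max_left _ _
        · exact le_max_left _ _
      · obtain ⟨v, hv, hvx⟩ := h3' x hx
        refine ⟨v, Submodule.mem_sup_right hv, hvx.trans ?_⟩
        gcongr
        · exact le_max_right _ _
        · exact le_max_right _ _
  · intro x hx
    obtain ⟨p, r, hp⟩ := hf x hx
    -- Strictly inside the ball of convergence the Taylor error is uniformly geometric.
    obtain ⟨r', hr'0, hr'⟩ := ENNReal.lt_iff_exists_nnreal_btwn.mp hp.r_pos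
    obtain ⟨a, ha, C, hC, h⟩ := hp.uniform_geometric_approx hr'
    have hr'pos : (0 : ℝ) < r' := by exact_mod_cast hr'0
    refine ⟨s ∩ Metric.ball x r', inter_mem_nhdsWithin _ (Metric.ball_mem_nhds _ hr'pos),
      1, C, a, hC, ha.1, ha.2, fun k => ?_⟩
    obtain ⟨V, h1, h2, h3⟩ := exists_finrank_le_partialSum_mem p k
    refine ⟨V, h1, by simpa using h2, fun y hy => ⟨p.partialSum k (y - x), h3 _, ?_⟩⟩
    have := h (y - x) (by simpa [dist_eq_norm] using hy.2) k (by simp [hy.1])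
    simpa using this

/-- An analytic function on a compact set is Lipschitz there. -/
theorem exists_lipschitzOnWith_of_analyticOn {E F : Type*} [NormedAddCommGroup E]
    [NormedSpace ℝ E] [NormedAddCommGroup F] [NormedSpace ℝ F] [CompleteSpace F] {f : E → F}
    {s : Set E} (hs : IsCompact s) (hf : AnalyticOn ℝ f s) :
    ∃ L : NNReal, LipschitzOnWith L f s := by
  refine LocallyLipschitzOn.exists_lipschitzOnWith_of_compact hs fun x hx => ?_
  -- Near `x`, `f` agrees on `s` with a function analytic in a full neighbourhood, which is strictly
  -- differentiable and hence locally Lipschitz.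
  obtain ⟨g, -, hfg, hg⟩ := (hf x hx).exists_analyticAt
  obtain ⟨L, t, ht, hL⟩ := hg.hasStrictFDerivAt.exists_lipschitzOnWith
  refine ⟨L, s ∩ t, inter_mem_nhdsWithin _ ht, ?_⟩
  intro y hy z hz
  rw [hfg (Set.mem_insert_of_mem _ hy.1), hfg (Set.mem_insert_of_mem _ hz.1)]
  exact hL hy.2 hz.2

end Widths

/-! ### From exponential decay in blocks to arbitrary polynomial rates -/

section Rate

theorem exists_succ_pow_mul_pow_le {b : ℝ} (hb : 0 < b) (hb1 : b < 1) (q : ℕ) :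
    ∃ C : ℝ, 0 < C ∧ ∀ k : ℕ, ((k : ℝ) + 1) ^ q * b ^ k ≤ C := by
  have h := tendsto_pow_const_mul_const_pow_of_abs_lt_one q (r := b)
    (by rwa [abs_of_pos hb])
  obtain ⟨C, hC⟩ := h.bddAbove_range
  refine ⟨max C 1 / b, by positivity, fun k => ?_⟩
  have := hC ⟨k + 1, rfl⟩
  rw [le_div_iff₀ hb]
  push_cast at this
  rw [pow_succ b k] at this
  linarith [le_max_left C 1]

/-- A quantity that is exponentially small in `k` as soon as `n ≥ Q k ^ e` decays faster than any
power of `n`. -/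
theorem exists_le_rpow_neg_of_exp_le {b A : ℝ} (hb : 0 < b) (hb1 : b < 1) (hA : 0 < A)
    {Q e : ℕ} (hQ : 0 < Q) (he : 0 < e) (α : ℝ) :
    ∃ C : ℝ, 0 < C ∧ ∀ (n : ℕ) (σ : ℝ), 1 ≤ n → (∀ k : ℕ, Q * k ^ e ≤ n → σ ≤ A * b ^ k) →
      σ ≤ C * (n : ℝ) ^ (-α) := by
  obtain ⟨s, hs⟩ := exists_nat_ge α
  obtain ⟨C, hC, h⟩ := exists_succ_pow_mul_pow_le hb hb1 (e * s)
  refine ⟨A * C * (Q : ℝ) ^ s, by positivity, fun n σ hn hσ => ?_⟩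
  -- The largest admissible `k`, so that `n ≤ Q (k + 1) ^ e` and powers of `n` are absorbed by `b ^
  -- k`. Searching up to `n` suffices because `k ≤ Q * k ^ e`.
  set k := Nat.findGreatest (fun k => Q * k ^ e ≤ n) n with hk
  have h1 : Q * k ^ e ≤ n :=
    Nat.findGreatest_spec (P := fun k => Q * k ^ e ≤ n) (Nat.zero_le n) (by simp [he.ne'])
  have h2 : n ≤ Q * (k + 1) ^ e := by
    by_contra! hlt
    have hkn : k + 1 ≤ n := by
      calc k + 1 ≤ (k + 1) ^ e := Nat.le_self_pow he.ne' _
        _ ≤ Q * (k + 1) ^ e := Nat.le_mul_of_pos_left _ hQ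
        _ ≤ n := hlt.le
    exact absurd (Nat.le_findGreatest (P := fun k => Q * k ^ e ≤ n) hkn hlt.le)
      (by rw [← hk]; omega)
  have hn1 : (1 : ℝ) ≤ n := by exact_mod_cast hn
  have h3 : (n : ℝ) ^ α ≤ (Q : ℝ) ^ s * ((k : ℝ) + 1) ^ (e * s) := by
    calc (n : ℝ) ^ α ≤ (n : ℝ) ^ (s : ℝ) := Real.rpow_le_rpow_of_exponent_le hn1 hs
      _ = (n : ℝ) ^ s := Real.rpow_natCast _ _
      _ ≤ ((Q : ℝ) * ((k : ℝ) + 1) ^ e) ^ s := by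
          gcongr
          exact_mod_cast h2
      _ = (Q : ℝ) ^ s * ((k : ℝ) + 1) ^ (e * s) := by rw [mul_pow, ← pow_mul]
  have hnα : 0 < (n : ℝ) ^ α := by positivity
  rw [Real.rpow_neg (by positivity), ← div_eq_mul_inv, le_div_iff₀ hnα]
  calc σ * (n : ℝ) ^ α ≤ A * b ^ k * ((Q : ℝ) ^ s * ((k : ℝ) + 1) ^ (e * s)) := by
        have := hσ k h1
        gcongr
    _ = A * (Q : ℝ) ^ s * (((k : ℝ) + 1) ^ (e * s) * b ^ k) := by ring
    _ ≤ A * (Q : ℝ) ^ s * C := by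
        have := h k
        gcongr
    _ = A * C * (Q : ℝ) ^ s := by ring

/-- Weak greedy selections from the image of a compact set under an analytic map of finitely many
variables converge faster than any power. -/
theorem exists_weakGreedy_infDist_le_rpow {d : ℕ} {E : Type*} [NormedAddCommGroup E]
    [InnerProductSpace ℝ E] [CompleteSpace E] {f : EuclideanSpace ℝ (Fin d) → E}
    {s : Set (EuclideanSpace ℝ (Fin d))} (hs : IsCompact s) (hf : AnalyticOn ℝ f s)
    {Γ : ℝ} (hΓ : 0 < Γ) (α : ℝ) :
    ∃ C : ℝ, 0 < C ∧ ∀ (sel : ℕ → EuclideanSpace ℝ (Fin d)) (n₀ : ℕ), (∀ j < n₀, sel j ∈ s) →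
      (∀ j < n₀, ∀ x ∈ s,
        Metric.infDist (f x) (Submodule.span ℝ ((fun i => f (sel i)) '' Set.Iio j) : Set E) ≤
        Γ * Metric.infDist (f (sel j))
          (Submodule.span ℝ ((fun i => f (sel i)) '' Set.Iio j) : Set E)) →
      ∀ n : ℕ, 1 ≤ n → n ≤ n₀ → ∀ x ∈ s,
        Metric.infDist (f x) (Submodule.span ℝ ((fun i => f (sel i)) '' Set.Iio n) : Set E) ≤
          C * (n : ℝ) ^ (-α) := by
  obtain ⟨N, C₁, a, hC₁, ha, ha1, hw⟩ := exists_widths_le_of_analyticOn hs hf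
  obtain ⟨M, hM⟩ := hs.exists_bound_of_continuousOn hf.continuousOn
  obtain ⟨K, hK⟩ := exists_nat_ge (2 * Γ)
  have hK0 : 0 < K := by
    have : (0 : ℝ) < K := by linarith
    exact_mod_cast this
  have hb : 0 < max a (1 / 2) := lt_max_of_lt_left ha
  -- The exponent `d + 2` counts `k` blocks of length `K ^ 2 * (N + 1) * k ^ (d + 1)`. `N + 1` keeps
  -- the length positive for `k > 0`, and `max M 0` covers an empty `s`.
  obtain ⟨C, hC, h⟩ := exists_le_rpow_neg_of_exp_le (A := max M 0 + 2 * Γ * C₁) hb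
    (max_lt ha1 (by norm_num)) (by positivity)
    (Q := K ^ 2 * (N + 1)) (e := d + 2) (by positivity) (by positivity) α
  refine ⟨C, hC, fun sel n₀ hsel hgr n hn hnn x hx => h n _ hn fun k hk => ?_⟩
  have hgoal : max M 0 * (1 / 2) ^ k + 2 * Γ * (C₁ * a ^ k) ≤
      (max M 0 + 2 * Γ * C₁) * max a (1 / 2) ^ k := by
    have h1 : (1 / 2 : ℝ) ^ k ≤ max a (1 / 2) ^ k := by gcongr; exact le_max_right _ _
    have h2 : a ^ k ≤ max a (1 / 2) ^ k := by gcongr; exact le_max_left _ _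
    calc _ ≤ max M 0 * max a (1 / 2) ^ k + 2 * Γ * (C₁ * max a (1 / 2) ^ k) := by gcongr
      _ = _ := by ring
  refine le_trans ?_ hgoal
  -- For `k = 0` the blocks are empty, and the norm bound alone suffices.
  rcases Nat.eq_zero_or_pos k with rfl | hk0
  · have h0 := Metric.infDist_le_dist_of_mem (x := f x)
      (Submodule.zero_mem (Submodule.span ℝ ((fun i => f (sel i)) '' Set.Iio n)))
    rw [dist_zero_right] at h0
    have h1 := hM x hx
    have h2 : 0 ≤ 2 * Γ * (C₁ * a ^ 0) := by positivity
    simp only [pow_zero, mul_one] at h2 ⊢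
    linarith [le_max_left M 0]
  obtain ⟨V, hV1, hV2, hV3⟩ := hw k
  have hcount : k * (K ^ 2 * ((N + 1) * k ^ (d + 1))) = K ^ 2 * (N + 1) * k ^ (d + 2) := by ring
  have key := weakGreedy_infDist_le (S := f '' s) (φ := fun i => f (sel i)) (n₀ := n₀)
    (M := max M 0) (d := C₁ * a ^ k) (K := K) (m := (N + 1) * k ^ (d + 1)) hΓ hK
    (by positivity) (by positivity)
    (by rintro _ ⟨y, hy, rfl⟩; exact (hM y hy).trans (le_max_left _ _))
    (fun j hj => ⟨sel j, hsel j hj, rfl⟩)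
    (by rintro j hj _ ⟨y, hy, rfl⟩; exact hgr j hj y hy)
    V (hV2.trans (by gcongr; omega))
    (by rintro _ ⟨y, hy, rfl⟩; exact hV3 y hy) k (by rw [hcount]; omega) (f x) ⟨x, hx, rfl⟩
  refine le_trans (infDist_span_image_Iio_anti _ ?_ _) key
  rw [hcount]; exact hk

end Rate

end GreedyControl

namespace GreedyControl

/-! ### Analyticity of integrals of operator exponentials -/

section IntegralCLM

/-- Integration over `[0, T]` as a continuous linear map on continuous functions. -/
noncomputable def integralCLM {T : ℝ} (hT : 0 ≤ T) (F : Type*) [NormedAddCommGroup F]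
    [NormedSpace ℝ F] : C(Set.Icc 0 T, F) →L[ℝ] F :=
  LinearMap.mkContinuous
    { toFun := fun f => ∫ t in (0 : ℝ)..T, Set.IccExtend hT f t
      map_add' := fun f g => intervalIntegral.integral_add
        (f.continuous.Icc_extend'.intervalIntegrable 0 T)
        (g.continuous.Icc_extend'.intervalIntegrable 0 T)
      map_smul' := fun c f => intervalIntegral.integral_smul c (Set.IccExtend hT f) }
    |T - 0|
    fun f => by
      rw [mul_comm]
      exact intervalIntegral.norm_integral_le_of_norm_le_const
        fun t _ => f.norm_coe_le_norm (Set.projIcc 0 T hT t)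

theorem integralCLM_apply_eq_intervalIntegral {T : ℝ} (hT : 0 ≤ T) {F : Type*}
    [NormedAddCommGroup F] [NormedSpace ℝ F] (f : C(Set.Icc 0 T, F)) (g : ℝ → F)
    (hfg : ∀ t, f t = g t) : integralCLM hT F f = ∫ t in (0 : ℝ)..T, g t := by
  refine intervalIntegral.integral_congr fun t ht => ?_
  rw [Set.uIcc_of_le hT] at ht
  rw [Set.IccExtend_of_mem hT f ht]
  exact hfg ⟨t, ht⟩

/-- Constant functions, as a continuous linear map. -/
noncomputable def constCLM (K : Type*) [TopologicalSpace K] [CompactSpace K] (F : Type*)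
    [NormedAddCommGroup F] [NormedSpace ℝ F] : F →L[ℝ] C(K, F) :=
  LinearMap.mkContinuous
    { toFun := fun x => ContinuousMap.const K x
      map_add' := fun _ _ => rfl
      map_smul' := fun _ _ => rfl }
    1 fun x => by
      rw [one_mul]
      exact (ContinuousMap.norm_le _ (norm_nonneg x)).mpr fun _ => le_rfl

theorem constCLM_apply (K : Type*) [TopologicalSpace K] [CompactSpace K] {F : Type*}
    [NormedAddCommGroup F] [NormedSpace ℝ F] (x : F) (t : K) : constCLM K F x t = x := rfl

/-- Evaluation at a point is a continuous ring homomorphism, so it commutes with the exponential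
series. -/
theorem continuousMap_exp_apply {K : Type*} [TopologicalSpace K] [CompactSpace K] {𝔸 : Type*}
    [NormedRing 𝔸] [NormedAlgebra ℝ 𝔸] [CompleteSpace 𝔸] (f : C(K, 𝔸)) (t : K) :
    NormedSpace.exp f t = NormedSpace.exp (f t) :=
  NormedSpace.map_exp_of_mem_ball (𝕂 := ℝ)
    ((Pi.evalRingHom (fun _ : K => 𝔸) t).comp ContinuousMap.coeFnRingHom)
    (continuous_eval_const t) f
    (by rw [NormedSpace.expSeries_radius_eq_top]; exact edist_lt_top _ _)

/-- The integral `∫₀ᵀ e^{(T-t)a} c e^{(T-t)b} dt` in a Banach algebra is analytic in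
`(a, c, b)`. -/
theorem analyticAt_integral_exp_mul_mul_exp {𝔸 : Type*} [NormedRing 𝔸] [NormedAlgebra ℝ 𝔸]
    [CompleteSpace 𝔸] {T : ℝ} (hT : 0 ≤ T) {E : Type*} [NormedAddCommGroup E] [NormedSpace ℝ E]
    {a c b : E → 𝔸} {x : E} (ha : AnalyticAt ℝ a x) (hc : AnalyticAt ℝ c x)
    (hb : AnalyticAt ℝ b x) :
    AnalyticAt ℝ (fun y => ∫ t in (0 : ℝ)..T,
      NormedSpace.exp ((T - t) • a y) * c y * NormedSpace.exp ((T - t) • b y)) x := by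
  -- The integrand is viewed as one element of the Banach algebra `C([0,T], 𝔸)`. There `exp` is
  -- analytic and integration is continuous and linear, so the parametric integral becomes a
  -- composition of analytic maps.
  let w : C(Set.Icc 0 T, 𝔸) := ⟨fun t => (T - t) • (1 : 𝔸), by fun_prop⟩
  have hw : ∀ (t : Set.Icc 0 T) (z : 𝔸), (w * constCLM (Set.Icc 0 T) 𝔸 z) t = (T - t) • z :=
    fun t z => smul_one_mul _ _
  have heq : (fun y => ∫ t in (0 : ℝ)..T,
      NormedSpace.exp ((T - t) • a y) * c y * NormedSpace.exp ((T - t) • b y)) =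
      fun y => integralCLM hT 𝔸 (NormedSpace.exp (w * constCLM (Set.Icc 0 T) 𝔸 (a y)) *
        constCLM (Set.Icc 0 T) 𝔸 (c y) *
        NormedSpace.exp (w * constCLM (Set.Icc 0 T) 𝔸 (b y))) := by
    funext y
    symm
    refine integralCLM_apply_eq_intervalIntegral hT _ _ fun t => ?_
    rw [ContinuousMap.mul_apply, ContinuousMap.mul_apply, continuousMap_exp_apply,
      continuousMap_exp_apply, hw, hw, constCLM_apply]
  rw [heq]
  have hconst : ∀ g : E → 𝔸, AnalyticAt ℝ g x →
      AnalyticAt ℝ (fun y => constCLM (Set.Icc 0 T) 𝔸 (g y)) x := fun g hg =>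
    ((constCLM (Set.Icc 0 T) 𝔸).analyticAt (g x)).comp_of_eq hg rfl
  have hexp : ∀ g : E → 𝔸, AnalyticAt ℝ g x →
      AnalyticAt ℝ (fun y => NormedSpace.exp (w * constCLM (Set.Icc 0 T) 𝔸 (g y))) x := by
    intro g hg
    have hm : AnalyticAt ℝ (fun y => w * constCLM (Set.Icc 0 T) 𝔸 (g y)) x :=
      AnalyticAt.fun_mul (𝕜 := ℝ) (A := C(Set.Icc 0 T, 𝔸)) analyticAt_const (hconst g hg)
    have he : AnalyticAt ℝ (NormedSpace.exp : C(Set.Icc 0 T, 𝔸) → C(Set.Icc 0 T, 𝔸))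
        (w * constCLM (Set.Icc 0 T) 𝔸 (g x)) := NormedSpace.exp_analytic _
    exact he.comp_of_eq hm rfl
  have hprod : AnalyticAt ℝ (fun y => NormedSpace.exp (w * constCLM (Set.Icc 0 T) 𝔸 (a y)) *
      constCLM (Set.Icc 0 T) 𝔸 (c y) * NormedSpace.exp (w * constCLM (Set.Icc 0 T) 𝔸 (b y))) x :=
    AnalyticAt.fun_mul (𝕜 := ℝ) (A := C(Set.Icc 0 T, 𝔸))
      (AnalyticAt.fun_mul (𝕜 := ℝ) (A := C(Set.Icc 0 T, 𝔸)) (hexp _ ha) (hconst _ hc)) (hexp _ hb)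
  exact ((integralCLM hT 𝔸).analyticAt _).comp_of_eq hprod rfl

end IntegralCLM

/-! ### The Gramian, its inverse and the variational characterisation -/

section Gramian

variable {X U : Type*} [NormedAddCommGroup X] [InnerProductSpace ℝ X] [CompleteSpace X]
  [NormedAddCommGroup U] [InnerProductSpace ℝ U] [CompleteSpace U]

/-- The adjoint on real Hilbert spaces as a real-linear continuous map. -/
noncomputable def adjointCLM (Y Z : Type*) [NormedAddCommGroup Y] [InnerProductSpace ℝ Y]
    [CompleteSpace Y] [NormedAddCommGroup Z] [InnerProductSpace ℝ Z] [CompleteSpace Z] :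
    (Y →L[ℝ] Z) →L[ℝ] (Z →L[ℝ] Y) :=
  LinearMap.mkContinuous
    { toFun := fun B => ContinuousLinearMap.adjoint B
      map_add' := fun A B => map_add _ A B
      map_smul' := fun c A => by simp }
    1 fun B => by simp

theorem analyticAt_gramian {T : ℝ} (hT : 0 ≤ T) (q : (X →L[ℝ] X) × (U →L[ℝ] X)) :
    AnalyticAt ℝ (fun p : (X →L[ℝ] X) × (U →L[ℝ] X) => gramian T p.1 p.2) q := by
  have hfst : AnalyticAt ℝ (fun p : (X →L[ℝ] X) × (U →L[ℝ] X) => p.1) q := analyticAt_fst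
  have hsnd : AnalyticAt ℝ (fun p : (X →L[ℝ] X) × (U →L[ℝ] X) => p.2) q := analyticAt_snd
  have hadj : AnalyticAt ℝ
      (fun p : (X →L[ℝ] X) × (U →L[ℝ] X) => adjointCLM X X p.1) q :=
    ((adjointCLM X X).analyticAt q.1).comp_of_eq hfst rfl
  have hadjB : AnalyticAt ℝ
      (fun p : (X →L[ℝ] X) × (U →L[ℝ] X) => adjointCLM U X p.2) q :=
    ((adjointCLM U X).analyticAt q.2).comp_of_eq hsnd rfl
  have hBB : AnalyticAt ℝ
      (fun p : (X →L[ℝ] X) × (U →L[ℝ] X) => p.2 ∘L adjointCLM U X p.2) q :=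
    ((ContinuousLinearMap.compL ℝ X U X).analyticAt_bilinear _).comp₂ hsnd hadjB
  have key := analyticAt_integral_exp_mul_mul_exp (𝔸 := X →L[ℝ] X) hT hfst hBB hadj
  have heq : (fun p : (X →L[ℝ] X) × (U →L[ℝ] X) => gramian T p.1 p.2) = fun p =>
      ∫ t in (0 : ℝ)..T, NormedSpace.exp ((T - t) • p.1) * (p.2 ∘L adjointCLM U X p.2) *
        NormedSpace.exp ((T - t) • adjointCLM X X p.1) := by
    funext p
    exact intervalIntegral.integral_congr fun t _ => ContinuousLinearMap.ext fun _ => rfl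
  rw [heq]
  exact key

theorem analyticAt_minimiser {T : ℝ} (hT : 0 ≤ T) (x₀ x₁ : X) (q : (X →L[ℝ] X) × (U →L[ℝ] X))
    (hq : IsUnit (gramian T q.1 q.2)) :
    AnalyticAt ℝ (fun p : (X →L[ℝ] X) × (U →L[ℝ] X) => minimiser T p.1 p.2 x₀ x₁) q := by
  have hfst : AnalyticAt ℝ (fun p : (X →L[ℝ] X) × (U →L[ℝ] X) => p.1) q := analyticAt_fst
  have h1 : AnalyticAt ℝ
      (fun p : (X →L[ℝ] X) × (U →L[ℝ] X) => (gramian T p.1 p.2).inverse) q := by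
    obtain ⟨u, hu⟩ := hq
    have h2 : AnalyticAt ℝ Ring.inverse (gramian T q.1 q.2) := hu ▸ analyticAt_inverse u
    rw [ContinuousLinearMap.ringInverse_eq_inverse] at h2
    exact h2.comp_of_eq (analyticAt_gramian hT q) rfl
  have h3 : AnalyticAt ℝ (fun p : (X →L[ℝ] X) × (U →L[ℝ] X) => target T p.1 x₀ x₁) q := by
    have h4 : AnalyticAt ℝ
        (fun p : (X →L[ℝ] X) × (U →L[ℝ] X) => NormedSpace.exp (T • p.1)) q :=
      (NormedSpace.exp_analytic _).comp_of_eq (hfst.const_smul (c := T)) rfl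
    have h5 : AnalyticAt ℝ
        (fun p : (X →L[ℝ] X) × (U →L[ℝ] X) => NormedSpace.exp (T • p.1) x₀) q :=
      ((ContinuousLinearMap.apply ℝ X x₀).analyticAt _).comp_of_eq h4 rfl
    exact analyticAt_const.sub h5
  exact ((ContinuousLinearMap.id ℝ (X →L[ℝ] X)).analyticAt_bilinear _).comp₂ h1 h3

theorem adjoint_exp_smul (A : X →L[ℝ] X) (s : ℝ) :
    ContinuousLinearMap.adjoint (NormedSpace.exp (s • A)) =
      NormedSpace.exp (s • ContinuousLinearMap.adjoint A) := by
  rw [← ContinuousLinearMap.star_eq_adjoint, NormedSpace.star_exp, star_smul,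
    ContinuousLinearMap.star_eq_adjoint]
  simp

theorem continuous_exp_smul (A : X →L[ℝ] X) (T : ℝ) :
    Continuous fun t : ℝ => NormedSpace.exp ((T - t) • A) := by
  have h : Continuous (NormedSpace.exp : (X →L[ℝ] X) → X →L[ℝ] X) :=
    continuous_iff_continuousAt.mpr fun x => (NormedSpace.exp_analytic (𝕂 := ℝ) x).continuousAt
  exact h.comp (by fun_prop)

theorem inner_gramian_apply (T : ℝ) (A : X →L[ℝ] X) (B : U →L[ℝ] X) (p q : X) :
    ⟪gramian T A B p, q⟫_ℝ = ∫ t in (0 : ℝ)..T,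
      ⟪ContinuousLinearMap.adjoint B (adjointState T A p t),
        ContinuousLinearMap.adjoint B (adjointState T A q t)⟫_ℝ := by
  have hc : Continuous fun t : ℝ => NormedSpace.exp ((T - t) • A) ∘L B ∘L
      ContinuousLinearMap.adjoint B ∘L
      NormedSpace.exp ((T - t) • ContinuousLinearMap.adjoint A) :=
    (continuous_exp_smul A T).clm_comp (continuous_const.clm_comp
      (continuous_const.clm_comp (continuous_exp_smul _ T)))
  have h := ((innerSL ℝ q) ∘L (ContinuousLinearMap.apply ℝ X p)).intervalIntegral_comp_comm
    (hc.intervalIntegrable (μ := MeasureTheory.volume) 0 T)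
  have h1 : ⟪gramian T A B p, q⟫_ℝ =
      ((innerSL ℝ q) ∘L (ContinuousLinearMap.apply ℝ X p)) (gramian T A B) :=
    real_inner_comm _ _
  rw [h1, gramian, ← h]
  refine intervalIntegral.integral_congr fun t _ => ?_
  simp only [ContinuousLinearMap.comp_apply, innerSL_apply_apply, ContinuousLinearMap.apply_apply,
    adjointState]
  rw [ContinuousLinearMap.adjoint_inner_right, ← adjoint_exp_smul,
    ContinuousLinearMap.adjoint_inner_right, real_inner_comm]

theorem inner_gramian_comm (T : ℝ) (A : X →L[ℝ] X) (B : U →L[ℝ] X) (p q : X) :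
    ⟪gramian T A B p, q⟫_ℝ = ⟪p, gramian T A B q⟫_ℝ := by
  rw [← real_inner_comm p, inner_gramian_apply, inner_gramian_apply]
  exact intervalIntegral.integral_congr fun t _ => real_inner_comm _ _

theorem costJ_eq (T : ℝ) (A : X →L[ℝ] X) (B : U →L[ℝ] X) (x₀ x₁ p : X) :
    costJ T A B x₀ x₁ p = 1 / 2 * ⟪gramian T A B p, p⟫_ℝ - ⟪target T A x₀ x₁, p⟫_ℝ := by
  rw [costJ, inner_gramian_apply, target, inner_sub_left, adjointState, sub_zero,
    ← adjoint_exp_smul, ContinuousLinearMap.adjoint_inner_right]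
  simp_rw [real_inner_self_eq_norm_sq]
  ring

variable {T : ℝ} {A : X →L[ℝ] X} {B : U →L[ℝ] X} {c : ℝ}

/-- Lax–Milgram: a coercive bounded operator is invertible. -/
theorem isUnit_gramian (hc : 0 < c) (h : ∀ x, c * ‖x‖ ^ 2 ≤ ⟪gramian T A B x, x⟫_ℝ) :
    IsUnit (gramian T A B) :=
  ContinuousLinearMap.isUnit_of_forall_le_norm_inner_map _ (c := ⟨c, hc.le⟩) hc fun x => by
    rw [mul_comm]
    exact (h x).trans (le_abs_self _)

theorem mul_norm_le_norm_gramian (h : ∀ x, c * ‖x‖ ^ 2 ≤ ⟪gramian T A B x, x⟫_ℝ) (x : X) :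
    c * ‖x‖ ≤ ‖gramian T A B x‖ := by
  rcases (norm_nonneg x).eq_or_lt with h0 | h0
  · rw [← h0, mul_zero]; exact norm_nonneg _
  · refine le_of_mul_le_mul_right ?_ h0
    calc c * ‖x‖ * ‖x‖ = c * ‖x‖ ^ 2 := by ring
      _ ≤ _ := h x
      _ ≤ _ := real_inner_le_norm _ _

theorem gramian_eq_target_iff (hu : IsUnit (gramian T A B)) (x₀ x₁ p : X) :
    gramian T A B p = target T A x₀ x₁ ↔ p = minimiser T A B x₀ x₁ := by
  obtain ⟨u, hu⟩ := hu
  have hi : (gramian T A B).IsInvertible :=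
    ⟨ContinuousLinearEquiv.unitsEquiv ℝ X u, by rw [← hu]; rfl⟩
  constructor
  · intro h
    rw [minimiser, ← h, hi.inverse_apply_self]
  · rintro rfl
    rw [minimiser, hi.self_apply_inverse]

/-- Completing the square: with `m` the minimiser, symmetry of `Λ` and `Λ m = x¹ - e^{TA} x⁰` give
`J(p) - J(m) = ½⟨Λ(p - m), p - m⟩`, which is positive for `p ≠ m`. -/
theorem costJ_minimiser_lt (hc : 0 < c) (h : ∀ x, c * ‖x‖ ^ 2 ≤ ⟪gramian T A B x, x⟫_ℝ)
    {x₀ x₁ p : X} (hp : p ≠ minimiser T A B x₀ x₁) :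
    costJ T A B x₀ x₁ (minimiser T A B x₀ x₁) < costJ T A B x₀ x₁ p := by
  have he := (gramian_eq_target_iff (isUnit_gramian hc h) x₀ x₁ _).mpr rfl
  set m := minimiser T A B x₀ x₁
  have h1 := h (p - m)
  have h2 : 0 < c * ‖p - m‖ ^ 2 := by
    have : 0 < ‖p - m‖ := norm_pos_iff.mpr (sub_ne_zero.mpr hp)
    positivity
  have h3 := inner_gramian_comm T A B p m
  rw [map_sub, inner_sub_left, inner_sub_right, inner_sub_right, h3, he,
    real_inner_comm (target T A x₀ x₁) p] at h1
  rw [costJ_eq, costJ_eq, he]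
  linarith

end Gramian

end GreedyControl

namespace GreedyControl

/-! ### Comparison of surrogate and true distances -/

section Surrogate

variable {X : Type*} [NormedAddCommGroup X] [NormedSpace ℝ X]

theorem mul_infDist_le_infDist_image {G : X →L[ℝ] X} {c : ℝ} (hc : 0 < c)
    (hG : ∀ x, c * ‖x‖ ≤ ‖G x‖) (S : Submodule ℝ X) (x : X) :
    c * Metric.infDist x (S : Set X) ≤ Metric.infDist (G x) (G '' (S : Set X)) := by
  refine (Metric.le_infDist ⟨_, Set.mem_image_of_mem G S.zero_mem⟩).mpr ?_
  rintro _ ⟨y, hy, rfl⟩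
  rw [dist_eq_norm, ← map_sub]
  refine le_trans ?_ (hG _)
  rw [← dist_eq_norm]
  have := Metric.infDist_le_dist_of_mem (x := x) hy
  gcongr

theorem infDist_image_le_mul_infDist {G : X →L[ℝ] X} {M : ℝ} (hM : 0 < M) (hG : ‖G‖ ≤ M)
    (S : Submodule ℝ X) (x : X) :
    Metric.infDist (G x) (G '' (S : Set X)) ≤ M * Metric.infDist x (S : Set X) := by
  rw [← div_le_iff₀' hM]
  refine (Metric.le_infDist ⟨_, S.zero_mem⟩).mpr fun y hy => ?_
  rw [div_le_iff₀' hM]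
  refine (Metric.infDist_le_dist_of_mem (Set.mem_image_of_mem G hy)).trans ?_
  rw [dist_eq_norm, ← map_sub, dist_eq_norm]
  exact G.le_of_opNorm_le hG _

end Surrogate

end GreedyControl

/-! ### The greedy control algorithm as a weak greedy selection -/

theorem mainTheorem3
    {X U : Type*} [NormedAddCommGroup X] [InnerProductSpace ℝ X] [CompleteSpace X]
    [NormedAddCommGroup U] [InnerProductSpace ℝ U] [CompleteSpace U]
    {d : ℕ} (𝒩 : Set (EuclideanSpace ℝ (Fin d))) (h𝒩 : IsCompact 𝒩)
    (T : ℝ) (hT : 0 < T) (x₀ x₁ : X)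
    (A : EuclideanSpace ℝ (Fin d) → X →L[ℝ] X)
    (B : EuclideanSpace ℝ (Fin d) → U →L[ℝ] X)
    (hAB : AnalyticOn ℝ (fun ν => (A ν, B ν)) 𝒩)
    (lamMinus lamPlus : ℝ) (hminus : 0 < lamMinus) (hplus : 0 < lamPlus)
    (hctrl : GreedyControl.UniformlyControllable T A B 𝒩 lamMinus lamPlus) :
    -- `φ⁰_ν` is the unique solution of `Λ_ν φ = x¹ - e^{T A_ν} x⁰`
    -- and the unique minimiser of `J_ν`
    (∀ ν ∈ 𝒩,
      (∀ p : X, GreedyControl.gramian T (A ν) (B ν) p = GreedyControl.target T (A ν) x₀ x₁ ↔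
        p = GreedyControl.phi T A B x₀ x₁ ν) ∧
      (∀ p : X, p ≠ GreedyControl.phi T A B x₀ x₁ ν →
        GreedyControl.costJ T (A ν) (B ν) x₀ x₁ (GreedyControl.phi T A B x₀ x₁ ν) <
          GreedyControl.costJ T (A ν) (B ν) x₀ x₁ p)) ∧
    -- `ν ↦ φ⁰_ν` is Lipschitz on `𝒩`
    (∃ L : NNReal, LipschitzOnWith L (GreedyControl.phi T A B x₀ x₁) 𝒩) ∧
    -- the errors of the greedy control algorithm decay at every polynomial order,
    -- uniformly in the tolerance, the discretisation and the choices made in the run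
    (∀ α : ℝ, 0 < α → ∃ C : ℝ, 0 < C ∧
      ∀ L : NNReal, LipschitzOnWith L (GreedyControl.phi T A B x₀ x₁) 𝒩 →
      ∀ ε : ℝ, 0 < ε → ∀ δ : ℝ, 0 < δ → 2 * L * lamMinus * δ ≤ ε →
      ∀ D : Finset (EuclideanSpace ℝ (Fin d)), GreedyControl.IsDiscretisation 𝒩 D δ →
      ∀ (sel : ℕ → EuclideanSpace ℝ (Fin d)) (k : ℕ),
        GreedyControl.IsGreedyRun T A B x₀ x₁ ε D sel k →
      ∀ n : ℕ, 1 ≤ n → n ≤ k → ∀ ν ∈ 𝒩,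
        Metric.infDist (GreedyControl.phi T A B x₀ x₁ ν)
          (GreedyControl.snapshotSpan T A B x₀ x₁ sel n : Set X) ≤ C * (n : ℝ) ^ (-α)) := by
  have hlow : ∀ ν ∈ 𝒩, ∀ x, lamMinus * ‖x‖ ^ 2 ≤
      ⟪GreedyControl.gramian T (A ν) (B ν) x, x⟫_ℝ := fun ν hν x => (hctrl ν hν x).1
  have hunit : ∀ ν ∈ 𝒩, IsUnit (GreedyControl.gramian T (A ν) (B ν)) := fun ν hν =>
    GreedyControl.isUnit_gramian hminus (hlow ν hν)
  have hphi : AnalyticOn ℝ (GreedyControl.phi T A B x₀ x₁) 𝒩 := fun ν hν =>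
    (GreedyControl.analyticAt_minimiser hT.le x₀ x₁ (A ν, B ν) (hunit ν hν)).comp_analyticWithinAt
      (f := fun ν => (A ν, B ν)) (hAB ν hν)
  have hsol : ∀ ν ∈ 𝒩, GreedyControl.gramian T (A ν) (B ν) (GreedyControl.phi T A B x₀ x₁ ν) =
      GreedyControl.target T (A ν) x₀ x₁ := fun ν hν =>
    (GreedyControl.gramian_eq_target_iff (hunit ν hν) x₀ x₁ _).mpr rfl
  refine ⟨fun ν hν => ⟨GreedyControl.gramian_eq_target_iff (hunit ν hν) x₀ x₁,
    fun p hp => GreedyControl.costJ_minimiser_lt hminus (hlow ν hν) hp⟩,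
    GreedyControl.exists_lipschitzOnWith_of_analyticOn h𝒩 hphi, fun α _ => ?_⟩
  have hgram : AnalyticOn ℝ (fun ν => GreedyControl.gramian T (A ν) (B ν)) 𝒩 := fun ν hν =>
    (GreedyControl.analyticAt_gramian hT.le (A ν, B ν)).comp_analyticWithinAt
      (f := fun ν => (A ν, B ν)) (hAB ν hν)
  -- The upper bound on `‖Λ_ν‖` comes from continuity on the compact set; the maximum with `1` makes
  -- it positive.
  obtain ⟨M₀, hM₀⟩ := h𝒩.exists_bound_of_continuousOn hgram.continuousOn
  set M := max M₀ 1 with hMdef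
  have hM : 0 < M := lt_max_of_lt_right one_pos
  -- The factor `2` pays for replacing `𝒩` by the net `D`.
  have hΓ : 0 < 2 * M / lamMinus := by positivity
  obtain ⟨C, hC, h⟩ := GreedyControl.exists_weakGreedy_infDist_le_rpow h𝒩 hphi hΓ α
  refine ⟨C, hC, fun L hL ε _ δ hδ hLδ D hD sel k hrun n hn hnk ν hν =>
    h sel k (fun j hj => hD.1 (hrun j hj).2.1) (fun j hj x hx => ?_) n hn hnk ν hν⟩
  obtain ⟨hbig, hsel, hmax⟩ := hrun j hj
  have hsurr : ∀ μ ∈ 𝒩, lamMinus * Metric.infDist (GreedyControl.phi T A B x₀ x₁ μ)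
      (GreedyControl.snapshotSpan T A B x₀ x₁ sel j : Set X) ≤
        GreedyControl.surrogate T A B x₀ x₁ sel j μ ∧
      GreedyControl.surrogate T A B x₀ x₁ sel j μ ≤
        M * Metric.infDist (GreedyControl.phi T A B x₀ x₁ μ)
          (GreedyControl.snapshotSpan T A B x₀ x₁ sel j : Set X) := by
    intro μ hμ
    rw [GreedyControl.surrogate, ← hsol μ hμ]
    exact ⟨GreedyControl.mul_infDist_le_infDist_image hminus
      (GreedyControl.mul_norm_le_norm_gramian (hlow μ hμ)) _ _,
      GreedyControl.infDist_image_le_mul_infDist hM ((hM₀ μ hμ).trans (le_max_left _ _)) _ _⟩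
  obtain ⟨μ, hμ, hxμ⟩ := hD.2 x hx
  change Metric.infDist (GreedyControl.phi T A B x₀ x₁ x)
      (GreedyControl.snapshotSpan T A B x₀ x₁ sel j : Set X) ≤ 2 * M / lamMinus *
    Metric.infDist (GreedyControl.phi T A B x₀ x₁ (sel j))
      (GreedyControl.snapshotSpan T A B x₀ x₁ sel j : Set X)
  have h1 : Metric.infDist (GreedyControl.phi T A B x₀ x₁ x)
      (GreedyControl.snapshotSpan T A B x₀ x₁ sel j : Set X) ≤
      Metric.infDist (GreedyControl.phi T A B x₀ x₁ μ)
        (GreedyControl.snapshotSpan T A B x₀ x₁ sel j : Set X) + L * δ :=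
    Metric.infDist_le_infDist_add_dist.trans (by
      have := hL.dist_le_mul x hx μ (hD.1 hμ)
      gcongr
      exact this.trans (by gcongr))
  have h2 := (hsurr μ (hD.1 hμ)).1.trans (hmax μ hμ)
  have h3 := (hsurr (sel j) (hD.1 hsel)).2
  -- Since the run has not stopped at stage `j`, the net error `lamMinus * L * δ ≤ ε / 2` is
  -- dominated by the maximal surrogate. This removes `ε` from the weak greedy inequality.
  have h4 : ε / 2 ≤ GreedyControl.surrogate T A B x₀ x₁ sel j (sel j) := by
    push Not at hbig
    obtain ⟨μ', hμ', hε⟩ := hbig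
    exact hε.trans (hmax μ' hμ')
  rw [div_mul_eq_mul_div, le_div_iff₀ hminus]
  have h5 := mul_le_mul_of_nonneg_right h1 hminus.le
  nlinarith [h2, h3, h4, h5, hLδ]
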